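/- Theorem. For every $\varepsilon>0$ there is a smooth embedding $f\colon S^1\times S^1\to S^5$ of the $2$-torus into the unit sphere $S^5\subset\mathbb{C}^3$ such that (a) the embedded torus $T=f(S^1\times S^1)$ is Legendrian: the contact form $\gamma=\iota_X\omega|_{S^5}$ vanishes on all tangent vectors of $T$, where $X$ is the position (Euler) vector field and $\omega=\sum_j dx^j\wedge dy^j$ is the standard symplectic form of $\mathbb{C}^3$; (b) $T$ is a minimal surface in $S^5$: its mean curvature vector in $S^5$ vanishes identically; (c) $T$ is not flat: its Gauss curvature $K$ (the curvature of the metric induced from $S^5$) is not identically zero; (d) $\sup_{x\in T}|K(x)|<\varepsilon$. -/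

import Mathlib

open scoped Manifold ContDiff

noncomputable section

namespace LegendrianTorus

/-- `ℂ³` with its standard Hermitian inner product (and, by restriction of scalars, the standard
Euclidean structure of `ℝ⁶`). -/
abbrev C3 : Type := EuclideanSpace ℂ (Fin 3)

instance finrank_C3 : Fact (Module.finrank ℝ C3 = 5 + 1) :=
  ⟨by rw [← Module.finrank_mul_finrank ℝ ℂ C3]; simp⟩

/-- The unit sphere `S⁵ ⊂ ℂ³`, a smooth 5-manifold. -/
abbrev S5 : Type := Metric.sphere (0 : C3) 1

/-- The 2-torus `S¹ × S¹`, a smooth 2-manifold. -/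
abbrev Torus : Type := Circle × Circle

/-- The model with corners of the 2-torus. -/
abbrev torusModel := (𝓡 1).prod (𝓡 1)

/-- A smooth map from the 2-torus to `S⁵` is an embedding if it is a homeomorphism onto its image
and its differential is injective at every point. -/
structure IsSmoothlyEmbedded (f : Torus → S5) : Prop where
  smooth : ContMDiff torusModel (𝓡 5) ∞ f
  immersion : ∀ p, Function.Injective (mfderiv torusModel (𝓡 5) f p)
  embedding : Topology.IsEmbedding f

/-- The standard symplectic form `ω = ∑ dxʲ ∧ dyʲ` on `ℂ³`. -/
def omega (v w : C3) : ℝ := ∑ j, ((v j).re * (w j).im - (v j).im * (w j).re)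

/-- `f` is Legendrian: the contact form `γ = ι_X ω` of `S⁵`, with `X` the position vector field,
vanishes on all tangent vectors of the surface. -/
def IsLegendrian (f : Torus → S5) : Prop :=
  ∀ (p : Torus) (v : TangentSpace torusModel p),
    omega (f p) (mfderiv torusModel 𝓘(ℝ, C3) (fun q => (f q : C3)) p v) = 0

/-- The coordinate plane. -/
abbrev Plane : Type := Fin 2 → ℝ

/-- The partial derivative `∂ᵢ h`. -/
def pd {V : Type} [NormedAddCommGroup V] [NormedSpace ℝ V] (i : Fin 2) (h : Plane → V)
    (x : Plane) : V :=
  fderiv ℝ h x (Pi.single i 1)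

/-- The first fundamental form `gᵢⱼ = ⟨∂ᵢ u, ∂ⱼ u⟩` of a parametrized surface `u` in `ℂ³ = ℝ⁶`. -/
def firstForm (u : Plane → C3) (x : Plane) : Matrix (Fin 2) (Fin 2) ℝ :=
  Matrix.of fun i j => inner ℝ (pd i u x) (pd j u x)

/-- The Christoffel symbol `Γᵏᵢⱼ = ½ ∑ₗ gᵏˡ (∂ᵢ gⱼₗ + ∂ⱼ gᵢₗ - ∂ₗ gᵢⱼ)` of a metric `g`. -/
def christoffel (g : Plane → Matrix (Fin 2) (Fin 2) ℝ) (k i j : Fin 2) (x : Plane) : ℝ :=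
  (1 / 2) * ∑ l, (g x)⁻¹ k l *
    (pd i (fun y => g y j l) x + pd j (fun y => g y i l) x - pd l (fun y => g y i j) x)

/-- The component `Rˡₖᵢⱼ` of the Riemann curvature tensor, `R(∂ᵢ, ∂ⱼ) ∂ₖ = ∑ₗ Rˡₖᵢⱼ ∂ₗ`, where
`R(X, Y) = ∇_X ∇_Y - ∇_Y ∇_X - ∇_[X,Y]`. -/
def riemann (g : Plane → Matrix (Fin 2) (Fin 2) ℝ) (l k i j : Fin 2) (x : Plane) : ℝ :=
  pd i (christoffel g l j k) x - pd j (christoffel g l i k) x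
    + ∑ m, (christoffel g l i m x * christoffel g m j k x
      - christoffel g l j m x * christoffel g m i k x)

/-- The Gauss curvature `g(R(∂₀, ∂₁) ∂₁, ∂₀) / det g` of a metric `g` in coordinates. -/
def metricCurvature (g : Plane → Matrix (Fin 2) (Fin 2) ℝ) (x : Plane) : ℝ :=
  (∑ l, g x l 0 * riemann g l 1 0 1 x) / (g x).det

/-- The second fundamental form in `S⁵` of a parametrized surface `u` in `S⁵`: the component of
`∂ᵢ ∂ⱼ u` that is tangent to `S⁵` (orthogonal to `u`) and normal to the surface. -/
def secondForm (u : Plane → C3) (i j : Fin 2) (x : Plane) : C3 :=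
  (Submodule.span ℝ {u x, pd 0 u x, pd 1 u x})ᗮ.starProjection (pd i (pd j u) x)

/-- The mean curvature vector in `S⁵`, half the trace of the second fundamental form. -/
def meanCurvature (u : Plane → C3) (x : Plane) : C3 :=
  (1 / 2 : ℝ) • ∑ i, ∑ j, (firstForm u x)⁻¹ i j • secondForm u i j x

/-- The surface `f` in the angular coordinates of the torus, that is, lifted to the universal
covering of the torus, as a map to `ℂ³`. -/
def lift (f : Torus → S5) (x : Plane) : C3 := f (Circle.exp (x 0), Circle.exp (x 1))

/-- `f` is minimal in `S⁵`: its mean curvature vector vanishes everywhere. -/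
def IsMinimal (f : Torus → S5) : Prop := ∀ x, meanCurvature (lift f) x = 0

/-- The Gauss curvature at the point `p` of the torus of the metric induced by `f`, computed in
angular coordinates. -/
def gaussCurvature (f : Torus → S5) (p : Torus) : ℝ :=
  metricCurvature (firstForm (lift f)) ![Complex.arg p.1, Complex.arg p.2]

/-- `f` is flat: its Gauss curvature vanishes identically. -/
def IsFlat (f : Torus → S5) : Prop := ∀ p, gaussCurvature f p = 0

end LegendrianTorus

end

/-! The torus is a surface of revolution `(z cos t, z sin t, w)` over a curve `(z, w)` in `S³ ⊂ ℂ²`.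
The system `z' = -h conj(zw)`, `w' = h conj(z)²` makes it both Legendrian and minimal, for any
positive parameter speed `h`. Under this system `(z²w)'` is real, so `σ = Im(z²w)` is conserved, and
with `E = |z|²` the induced metric `h²E ds² + E dt²` has curvature `1 - 2σ²/E³`. The constant
solution `E = 2/3` gives a flat torus; its small oscillations give nearly flat, non-flat surfaces.

These oscillations are explicit. One has `Re(z²w)² = E²(1 - E) - σ²`, a cubic in `E`. Parametrize
its roots as `2(1 ± k)/(3 + k²)` and `-(1 - k²)/(3 + k²)`, and choose `h` so that `E = 2(1 + k cos
x)/(3 + k²)`. Then only the argument of `z` requires an integral, `rot`; the argument of `w` follows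
from `z²w`. The curvature becomes `1 - (1 - k²)²/(1 + k cos x)³`, which is `O(k)` and not
identically zero (`curvature_curve`, `abs_curvature_le`).

One oscillation multiplies `z` by `e^{iα}` and `w` by `e^{-2iα}`, where `α = rot k (2π)`, so the
curve closes when `α/2π` is rational. At `k = 0`, `α = π/√3`; a second-order estimate
(`rate_polynomial_bound`) shows that `α` is strictly smaller for small `k > 0`. By continuity `α =
2πp/q` for arbitrarily small `k`, with `q` an odd prime and `0 < p < q` (`exists_rot_eq`). Primality
and oddness of `q` exclude self-intersections (`exp_eq_of_curve_eq`). -/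

open scoped ComplexConjugate

noncomputable section

namespace LegendrianTorus

/-- The point of `ℂ³` with the given coordinates. -/
def vec (a b c : ℂ) : C3 := (PiLp.continuousLinearEquiv 2 ℝ fun _ : Fin 3 => ℂ).symm ![a, b, c]

@[simp] lemma vec_zero (a b c : ℂ) : vec a b c 0 = a := rfl
@[simp] lemma vec_one (a b c : ℂ) : vec a b c 1 = b := rfl
@[simp] lemma vec_two (a b c : ℂ) : vec a b c 2 = c := rfl

lemma vec_ext {v w : C3} (h0 : v 0 = w 0) (h1 : v 1 = w 1) (h2 : v 2 = w 2) : v = w := by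
  ext i; fin_cases i <;> assumption

lemma ContDiff.vec {E : Type*} [NormedAddCommGroup E] [NormedSpace ℝ E] {a b c : E → ℂ}
    (ha : ContDiff ℝ ∞ a) (hb : ContDiff ℝ ∞ b) (hc : ContDiff ℝ ∞ c) :
    ContDiff ℝ ∞ fun x => vec (a x) (b x) (c x) := by
  refine (PiLp.continuousLinearEquiv 2 ℝ fun _ : Fin 3 => ℂ).symm.contDiff.comp
    (contDiff_pi.2 fun i => ?_)
  fin_cases i <;> assumption

lemma HasDerivAt.vec {a b c : ℝ → ℂ} {a' b' c' : ℂ} {t : ℝ} (ha : HasDerivAt a a' t)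
    (hb : HasDerivAt b b' t) (hc : HasDerivAt c c' t) :
    HasDerivAt (fun t => vec (a t) (b t) (c t)) (vec a' b' c') t := by
  refine (PiLp.continuousLinearEquiv 2 ℝ fun _ : Fin 3 => ℂ).symm.hasFDerivAt.comp_hasDerivAt t
    (hasDerivAt_pi.2 fun i => ?_)
  fin_cases i <;> assumption

lemma inner_eq (a b : C3) :
    inner ℝ a b = ∑ i, ((a i).re * (b i).re + (a i).im * (b i).im) := by
  simp [PiLp.inner_apply, mul_comm]

/-! ### Partial derivatives in the coordinate plane -/

section pd

variable {V : Type} [NormedAddCommGroup V] [NormedSpace ℝ V]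

/-- Differentiability is essential: where it fails, `fderiv` is zero by default and says nothing
about the derivative along a coordinate line. -/
lemma pd_zero_eq {φ : Plane → V} {x : Plane} (hφ : DifferentiableAt ℝ φ x) {d : V}
    (hd : HasDerivAt (fun s => φ ![s, x 1]) d (x 0)) : pd 0 φ x = d := by
  have hx : ![x 0, x 1] = x := by ext i; fin_cases i <;> rfl
  have h1 : HasDerivAt (fun s : ℝ => (![s, x 1] : Plane)) (Pi.single 0 1) (x 0) := by
    refine hasDerivAt_pi.2 fun i => ?_
    fin_cases i
    · simpa using hasDerivAt_id' (x 0)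
    · simpa using hasDerivAt_const (x 0) (x 1)
  have h2 : HasFDerivAt φ (fderiv ℝ φ x) ![x 0, x 1] := by rw [hx]; exact hφ.hasFDerivAt
  exact (h2.comp_hasDerivAt (x 0) h1).unique hd

lemma pd_one_eq {φ : Plane → V} {x : Plane} (hφ : DifferentiableAt ℝ φ x) {d : V}
    (hd : HasDerivAt (fun s => φ ![x 0, s]) d (x 1)) : pd 1 φ x = d := by
  have hx : ![x 0, x 1] = x := by ext i; fin_cases i <;> rfl
  have h1 : HasDerivAt (fun s : ℝ => (![x 0, s] : Plane)) (Pi.single 1 1) (x 1) := by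
    refine hasDerivAt_pi.2 fun i => ?_
    fin_cases i
    · simpa using hasDerivAt_const (x 1) (x 0)
    · simpa using hasDerivAt_id' (x 1)
  have h2 : HasFDerivAt φ (fderiv ℝ φ x) ![x 0, x 1] := by rw [hx]; exact hφ.hasFDerivAt
  exact (h2.comp_hasDerivAt (x 1) h1).unique hd

lemma pd_zero_comp {φ : ℝ → V} {x : Plane} {d : V} (hd : HasDerivAt φ d (x 0)) :
    pd 0 (fun y : Plane => φ (y 0)) x = d := by
  refine pd_zero_eq ?_ (by simpa using hd)
  exact hd.differentiableAt.comp x (differentiableAt_apply 0 x)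

lemma pd_one_comp {φ : ℝ → V} {x : Plane} (hd : DifferentiableAt ℝ φ (x 0)) :
    pd 1 (fun y : Plane => φ (y 0)) x = 0 := by
  refine pd_one_eq ?_ (by simpa using hasDerivAt_const (x 1) (φ (x 0)))
  exact hd.comp x (differentiableAt_apply 0 x)

lemma fderiv_eq_pd (φ : Plane → V) (x v : Plane) :
    fderiv ℝ φ x v = v 0 • pd 0 φ x + v 1 • pd 1 φ x := by
  have hv : v = v 0 • Pi.single 0 1 + v 1 • Pi.single 1 1 := by
    ext i; fin_cases i <;> simp
  conv_lhs => rw [hv]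
  simp [pd]

end pd

/-! ### Curvature of a diagonal metric -/

lemma inv_diagonal {a b : ℝ} (ha : a ≠ 0) (hb : b ≠ 0) :
    (!![a, 0; 0, b] : Matrix (Fin 2) (Fin 2) ℝ)⁻¹ = !![a⁻¹, 0; 0, b⁻¹] := by
  refine Matrix.inv_eq_right_inv ?_
  ext i j
  fin_cases i <;> fin_cases j <;>
    simp [Matrix.mul_apply, Fin.sum_univ_two, mul_inv_cancel₀ ha, mul_inv_cancel₀ hb]

/-- The Gauss curvature of a metric `A ds² + B dt²` whose coefficients depend on `s` only. -/
lemma metricCurvature_diagonal {A B : ℝ → ℝ} (hA0 : ∀ s, 0 < A s) (hB0 : ∀ s, 0 < B s)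
    {b : ℝ → ℝ} (hb : ∀ s, HasDerivAt B (b s) s)
    {a : ℝ → ℝ} (ha : ∀ s, HasDerivAt A (a s) s) {x : Plane} {c : ℝ}
    (hc : HasDerivAt (fun s => -b s / (2 * A s)) c (x 0)) :
    metricCurvature (fun x => !![A (x 0), 0; 0, B (x 0)]) x =
      (c + a (x 0) / (2 * A (x 0)) * (-b (x 0) / (2 * A (x 0)))
        + b (x 0) / (2 * A (x 0)) * (b (x 0) / (2 * B (x 0)))) / B (x 0) := by
  set g : Plane → Matrix (Fin 2) (Fin 2) ℝ := fun x => !![A (x 0), 0; 0, B (x 0)] with hg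
  have hinv : ∀ y : Plane, (g y)⁻¹ = !![(A (y 0))⁻¹, 0; 0, (B (y 0))⁻¹] := fun y =>
    inv_diagonal (hA0 _).ne' (hB0 _).ne'
  have d00 : ∀ y, pd 0 (fun y => g y 0 0) y = a (y 0) := fun y => pd_zero_comp (ha _)
  have d01 : ∀ y, pd 0 (fun y => g y 0 1) y = 0 := fun y =>
    pd_zero_comp (φ := fun _ => (0 : ℝ)) (hasDerivAt_const _ _)
  have d010 : ∀ y, pd 0 (fun y => g y 1 0) y = 0 := fun y =>
    pd_zero_comp (φ := fun _ => (0 : ℝ)) (hasDerivAt_const _ _)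
  have d011 : ∀ y, pd 0 (fun y => g y 1 1) y = b (y 0) := fun y => pd_zero_comp (hb _)
  have e00 : ∀ y, pd 1 (fun y => g y 0 0) y = 0 := fun y =>
    pd_one_comp (ha _).differentiableAt
  have e01 : ∀ y, pd 1 (fun y => g y 0 1) y = 0 := fun y =>
    pd_one_comp (φ := fun _ => (0 : ℝ)) (differentiableAt_const _)
  have e10 : ∀ y, pd 1 (fun y => g y 1 0) y = 0 := fun y =>
    pd_one_comp (φ := fun _ => (0 : ℝ)) (differentiableAt_const _)
  have e11 : ∀ y, pd 1 (fun y => g y 1 1) y = 0 := fun y =>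
    pd_one_comp (hb _).differentiableAt
  have c000 : ∀ y, christoffel g 0 0 0 y = a (y 0) / (2 * A (y 0)) := by
    intro y
    simp only [christoffel, Fin.sum_univ_two, hinv, d00, d01, e00]
    simp; ring
  have c011 : christoffel g 0 1 1 = fun y => (fun s => -b s / (2 * A s)) (y 0) := by
    ext y
    simp only [christoffel, Fin.sum_univ_two, hinv, e10, d011, e11]
    simp; ring
  have c001 : christoffel g 0 0 1 = fun y => (fun _ => (0 : ℝ)) (y 0) := by
    ext y
    simp only [christoffel, Fin.sum_univ_two, hinv, d010, d011, d01, e00, e01]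
    simp
  have c010 : ∀ y, christoffel g 0 1 0 y = 0 := by
    intro y
    simp only [christoffel, Fin.sum_univ_two, hinv, d010, d011, e00, e10, e01]
    simp
  have c111 : ∀ y, christoffel g 1 1 1 y = 0 := by
    intro y
    simp only [christoffel, Fin.sum_univ_two, hinv, e10, d011, e11]
    simp
  have c101 : ∀ y, christoffel g 1 0 1 y = b (y 0) / (2 * B (y 0)) := by
    intro y
    simp only [christoffel, Fin.sum_univ_two, hinv, d010, d011, d01, e00, e01]
    simp; ring
  have hR : riemann g 0 1 0 1 x = c + a (x 0) / (2 * A (x 0)) * (-b (x 0) / (2 * A (x 0)))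
        + b (x 0) / (2 * A (x 0)) * (b (x 0) / (2 * B (x 0))) := by
    simp only [riemann, Fin.sum_univ_two, c000, c111, c101, c010]
    rw [c011, c001, pd_zero_comp hc, pd_one_comp (differentiableAt_const _)]
    ring
  have hAx := (hA0 (x 0)).ne'
  have hBx := (hB0 (x 0)).ne'
  have hg00 : g x 0 0 = A (x 0) := rfl
  have hg10 : g x 1 0 = 0 := rfl
  have hdet : (g x).det = A (x 0) * B (x 0) := by simp [hg, Matrix.det_fin_two]
  rw [metricCurvature, Fin.sum_univ_two, hR, hg00, hg10, hdet, zero_mul, add_zero,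
    mul_div_mul_left _ _ hAx]

/-! ### Geometry of the surface of revolution -/

/-- A Legendrian curve `(z, w)` in the unit sphere of `ℂ²`, with speed `h |z|`, whose rotation
`(z cos t, z sin t, w)` is a minimal Legendrian surface in `S⁵`. -/
structure IsProfile (z w : ℝ → ℂ) (h : ℝ → ℝ) : Prop where
  contDiff_z : ContDiff ℝ ∞ z
  contDiff_w : ContDiff ℝ ∞ w
  contDiff_h : ContDiff ℝ ∞ h
  h_pos : ∀ s, 0 < h s
  z_ne : ∀ s, z s ≠ 0
  normSq_add : ∀ s, Complex.normSq (z s) + Complex.normSq (w s) = 1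
  deriv_z : ∀ s, HasDerivAt z (h s * -conj (z s * w s)) s
  deriv_w : ∀ s, HasDerivAt w (h s * conj (z s) ^ 2) s

/-- The surface of revolution `(z cos t, z sin t, w)`. -/
def surface (z w : ℝ → ℂ) (x : Plane) : C3 :=
  vec (z (x 0) * Real.cos (x 1)) (z (x 0) * Real.sin (x 1)) (w (x 0))

namespace IsProfile

variable {z w : ℝ → ℂ} {h : ℝ → ℝ}

lemma contDiff_ofReal_comp {E : Type*} [NormedAddCommGroup E] [NormedSpace ℝ E] {φ : E → ℝ}
    (hφ : ContDiff ℝ ∞ φ) : ContDiff ℝ ∞ fun x => (φ x : ℂ) :=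
  Complex.ofRealCLM.contDiff.comp hφ

lemma contDiff_revolution {a b : ℝ → ℂ} {p q : ℝ → ℝ} {c : ℝ → ℂ} (ha : ContDiff ℝ ∞ a)
    (hb : ContDiff ℝ ∞ b) (hc : ContDiff ℝ ∞ c) (hp : ContDiff ℝ ∞ p) (hq : ContDiff ℝ ∞ q) :
    ContDiff ℝ ∞ fun x : Plane => vec (a (x 0) * p (x 1)) (b (x 0) * q (x 1)) (c (x 0)) := by
  have h0 : ContDiff ℝ ∞ fun x : Plane => x 0 := contDiff_apply ℝ ℝ 0
  have h1 : ContDiff ℝ ∞ fun x : Plane => x 1 := contDiff_apply ℝ ℝ 1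
  exact ContDiff.vec ((ha.comp h0).mul (contDiff_ofReal_comp (hp.comp h1)))
    ((hb.comp h0).mul (contDiff_ofReal_comp (hq.comp h1))) (hc.comp h0)

lemma contDiff_conj {φ : ℝ → ℂ} (hφ : ContDiff ℝ ∞ φ) : ContDiff ℝ ∞ fun s => conj (φ s) :=
  Complex.conjCLE.contDiff.comp hφ

lemma hasDerivAt_conj {φ : ℝ → ℂ} {d : ℂ} {s : ℝ} (hφ : HasDerivAt φ d s) :
    HasDerivAt (fun s => conj (φ s)) (conj d) s :=
  Complex.conjCLE.hasFDerivAt.comp_hasDerivAt s hφ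

lemma contDiff_surface (H : IsProfile z w h) : ContDiff ℝ ∞ (surface z w) :=
  contDiff_revolution H.contDiff_z H.contDiff_z H.contDiff_w Real.contDiff_cos Real.contDiff_sin

lemma pd_zero_surface (H : IsProfile z w h) (x : Plane) :
    pd 0 (surface z w) x = h (x 0) • vec (-conj (z (x 0) * w (x 0)) * Real.cos (x 1))
      (-conj (z (x 0) * w (x 0)) * Real.sin (x 1)) (conj (z (x 0)) ^ 2) := by
  refine pd_zero_eq (H.contDiff_surface.differentiable (by simp)).differentiableAt ?_
  have hz := H.deriv_z (x 0)
  refine (HasDerivAt.vec (hz.mul_const (Real.cos (x 1) : ℂ)) (hz.mul_const (Real.sin (x 1) : ℂ))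
    (H.deriv_w (x 0))).congr_deriv ?_
  refine vec_ext ?_ ?_ ?_ <;> simp [mul_assoc]

lemma hasDerivAt_cos (t : ℝ) :
    HasDerivAt (fun t : ℝ => (Real.cos t : ℂ)) (-(Real.sin t : ℂ)) t := by
  simpa using (Real.hasDerivAt_cos t).ofReal_comp

lemma hasDerivAt_sin (t : ℝ) :
    HasDerivAt (fun t : ℝ => (Real.sin t : ℂ)) (Real.cos t : ℂ) t :=
  (Real.hasDerivAt_sin t).ofReal_comp

lemma pd_one_surface (H : IsProfile z w h) (x : Plane) :
    pd 1 (surface z w) x =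
      vec (z (x 0) * -Real.sin (x 1)) (z (x 0) * Real.cos (x 1)) 0 := by
  refine pd_one_eq (H.contDiff_surface.differentiable (by simp)).differentiableAt ?_
  exact HasDerivAt.vec ((hasDerivAt_cos (x 1)).const_mul (z (x 0)))
    ((hasDerivAt_sin (x 1)).const_mul (z (x 0))) (hasDerivAt_const _ (w (x 0)))

lemma pd_one_pd_one_surface (H : IsProfile z w h) (x : Plane) :
    pd 1 (pd 1 (surface z w)) x =
      vec (z (x 0) * -Real.cos (x 1)) (z (x 0) * -Real.sin (x 1)) 0 := by
  rw [funext H.pd_one_surface]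
  refine pd_one_eq ?_ ?_
  · have := contDiff_revolution (p := fun t => -Real.sin t) H.contDiff_z H.contDiff_z
      (contDiff_const (c := (0 : ℂ))) Real.contDiff_sin.neg Real.contDiff_cos
    simpa using (this.differentiable (by simp)).differentiableAt
  · simp only [Matrix.cons_val_zero, Matrix.cons_val_one]
    exact HasDerivAt.vec ((hasDerivAt_sin _).neg.const_mul _) ((hasDerivAt_cos _).const_mul _)
      (hasDerivAt_const _ _)

lemma normSq_w (H : IsProfile z w h) (s : ℝ) :
    (Complex.normSq (w s) : ℂ) = 1 - Complex.normSq (z s) := by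
  rw [eq_sub_iff_add_eq', ← Complex.ofReal_add, H.normSq_add, Complex.ofReal_one]

/-- The terms are arranged for the trace: the first is tangent to the surface, the last is normal to
the sphere, and the middle one is `-h²` times `∂₁∂₁u`. -/
lemma pd_zero_pd_zero_surface (H : IsProfile z w h) (x : Plane) :
    pd 0 (pd 0 (surface z w)) x = deriv h (x 0) •
        vec (-conj (z (x 0) * w (x 0)) * Real.cos (x 1))
          (-conj (z (x 0) * w (x 0)) * Real.sin (x 1)) (conj (z (x 0)) ^ 2) +
      h (x 0) ^ 2 • (vec (z (x 0) * Real.cos (x 1)) (z (x 0) * Real.sin (x 1)) 0 -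
        (2 * Complex.normSq (z (x 0))) • surface z w x) := by
  rw [funext H.pd_zero_surface]
  have hhd : HasDerivAt h (deriv h (x 0)) (x 0) :=
    (H.contDiff_h.differentiable (by simp)).differentiableAt.hasDerivAt
  have hz := H.deriv_z (x 0)
  have hw := H.deriv_w (x 0)
  have hzw := (hasDerivAt_conj (hz.mul hw)).neg
  have hzc := (hasDerivAt_conj hz).pow 2
  refine pd_zero_eq ?_ ?_
  · have hc := (contDiff_conj (H.contDiff_z.mul H.contDiff_w)).neg
    have h1 := contDiff_revolution hc hc ((contDiff_conj H.contDiff_z).pow 2)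
      Real.contDiff_cos Real.contDiff_sin
    have h0 : ContDiff ℝ ∞ fun x : Plane => h (x 0) := H.contDiff_h.comp (contDiff_apply ℝ ℝ 0)
    exact ((h0.smul h1).differentiable (by simp)).differentiableAt
  · refine (hhd.smul (HasDerivAt.vec (hzw.mul_const (Real.cos (x 1) : ℂ))
      (hzw.mul_const (Real.sin (x 1) : ℂ)) hzc)).congr_deriv ?_
    have hN := H.normSq_w (x 0)
    rw [← Complex.mul_conj, ← Complex.mul_conj] at hN
    have key : -((starRingEnd ℂ) (h (x 0) * -conj (z (x 0) * w (x 0)) * w (x 0)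
        + z (x 0) * (h (x 0) * conj (z (x 0)) ^ 2)))
        = h (x 0) * (z (x 0) - 2 * (z (x 0) * conj (z (x 0))) * z (x 0)) := by
      simp only [map_add, map_mul, map_neg, map_pow, Complex.conj_conj, Complex.conj_ofReal]
      linear_combination (h (x 0)) * z (x 0) * hN
    simp only [key]
    rw [add_comm]
    congr 1
    simp only [surface]
    have hE : ((Complex.normSq (z (x 0)) : ℝ) : ℂ) = z (x 0) * conj (z (x 0)) :=
      (Complex.mul_conj _).symm
    refine vec_ext ?_ ?_ ?_
    · simp [hE]; ring
    · simp [hE]; ring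
    · simp [hE]; ring

end IsProfile

namespace IsProfile

variable {z w : ℝ → ℂ} {h : ℝ → ℝ}

lemma normSq_add' (H : IsProfile z w h) (s : ℝ) :
    (z s).re ^ 2 + (z s).im ^ 2 + (w s).re ^ 2 + (w s).im ^ 2 = 1 := by
  have := H.normSq_add s
  simp only [Complex.normSq_apply] at this
  linarith

lemma norm_surface (H : IsProfile z w h) (x : Plane) : ‖surface z w x‖ = 1 := by
  have h1 : ‖surface z w x‖ ^ 2 = 1 := by
    rw [← real_inner_self_eq_norm_sq, inner_eq, Fin.sum_univ_three]
    simp [surface, -Complex.ofReal_cos, -Complex.ofReal_sin]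
    linear_combination H.normSq_add' (x 0)
      + ((z (x 0)).re ^ 2 + (z (x 0)).im ^ 2) * Real.cos_sq_add_sin_sq (x 1)
  nlinarith [norm_nonneg (surface z w x)]

lemma firstForm_surface (H : IsProfile z w h) : firstForm (surface z w) = fun x =>
    !![h (x 0) ^ 2 * Complex.normSq (z (x 0)), 0; 0, Complex.normSq (z (x 0))] := by
  funext x
  have h1 := H.normSq_add' (x 0)
  have h2 := Real.cos_sq_add_sin_sq (x 1)
  ext i j
  fin_cases i <;> fin_cases j <;>
    simp [firstForm, H.pd_zero_surface, H.pd_one_surface, inner_eq,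
      Fin.sum_univ_three, Complex.normSq_apply, pow_two, -Complex.ofReal_cos,
      -Complex.ofReal_sin]
  · set a := (z (x 0)).re
    set b := (z (x 0)).im
    set c := (w (x 0)).re
    set d := (w (x 0)).im
    linear_combination h (x 0) ^ 2 * (a ^ 2 + b ^ 2) * (c ^ 2 + d ^ 2) * h2
      + h (x 0) ^ 2 * (a ^ 2 + b ^ 2) * h1
  · ring
  · ring
  · linear_combination ((z (x 0)).re ^ 2 + (z (x 0)).im ^ 2) * h2

lemma normSq_z_pos (H : IsProfile z w h) (s : ℝ) : 0 < Complex.normSq (z s) :=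
  Complex.normSq_pos.2 (H.z_ne s)

lemma hasDerivAt_normSq_z (H : IsProfile z w h) (s : ℝ) :
    HasDerivAt (fun s => Complex.normSq (z s)) (-2 * h s * (z s ^ 2 * w s).re) s := by
  have h1 := (H.deriv_z s).mul (hasDerivAt_conj (H.deriv_z s))
  have h2 := Complex.reCLM.hasFDerivAt.comp_hasDerivAt s h1
  have h3 : (fun s => Complex.normSq (z s)) = Complex.reCLM ∘ (z * fun s => conj (z s)) := by
    ext s; simp [Complex.mul_conj]
  rw [h3]
  refine h2.congr_deriv ?_
  simp [pow_two]
  ring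

/-- The derivative of `z²w` itself is this real expression, by `|w|² = 1 - |z|²`; this is the
conservation of `Im(z²w)`. -/
lemma hasDerivAt_re (H : IsProfile z w h) (s : ℝ) :
    HasDerivAt (fun s => (z s ^ 2 * w s).re)
      (h s * (3 * Complex.normSq (z s) ^ 2 - 2 * Complex.normSq (z s))) s := by
  have h1 := ((H.deriv_z s).pow 2).mul (H.deriv_w s)
  have h2 := Complex.reCLM.hasFDerivAt.comp_hasDerivAt s h1
  refine h2.congr_deriv ?_
  have hN := H.normSq_w s
  have key : (h s : ℂ) * (3 * Complex.normSq (z s) ^ 2 - 2 * Complex.normSq (z s)) =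
      ((2 : ℕ) * z s ^ (2 - 1) * (h s * -conj (z s * w s))) * w s
        + z s ^ 2 * (h s * conj (z s) ^ 2) := by
    rw [← Complex.mul_conj] at *
    rw [← Complex.mul_conj] at hN
    simp only [map_mul]
    push_cast
    linear_combination 2 * h s * (z s * conj (z s)) * hN
  have := congrArg Complex.re key
  rw [← Complex.ofReal_pow] at this
  simp only [Complex.reCLM_apply]
  refine Eq.trans this.symm ?_
  norm_cast

/-- The Gauss curvature of the surface of revolution of a profile curve. -/
lemma metricCurvature_surface (H : IsProfile z w h) (x : Plane) :
    metricCurvature (firstForm (surface z w)) x =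
      1 - 2 * (z (x 0) ^ 2 * w (x 0)).im ^ 2 / Complex.normSq (z (x 0)) ^ 3 := by
  have hE := H.normSq_z_pos
  have hE' := H.hasDerivAt_normSq_z
  have hh : ∀ s, HasDerivAt h (deriv h s) s := fun s =>
    (H.contDiff_h.differentiable (by simp)).differentiableAt.hasDerivAt
  have h0 := H.h_pos
  -- With `A = h²E` and `B = E`, the quotient `-B'/(2A)` is `Re(z²w)/(hE)`; the witness `c` is its
  -- derivative, so `h` is differentiated only once.
  rw [H.firstForm_surface, metricCurvature_diagonal
    (A := fun s => h s ^ 2 * Complex.normSq (z s)) (B := fun s => Complex.normSq (z s))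
    (fun s => mul_pos (pow_pos (h0 s) 2) (hE s)) hE hE' (fun s => ((hh s).pow 2).mul (hE' s))
    (c := (h (x 0) * (3 * Complex.normSq (z (x 0)) ^ 2 - 2 * Complex.normSq (z (x 0)))
      * (h (x 0) * Complex.normSq (z (x 0))) - (z (x 0) ^ 2 * w (x 0)).re
      * (deriv h (x 0) * Complex.normSq (z (x 0))
        + h (x 0) * (-2 * h (x 0) * (z (x 0) ^ 2 * w (x 0)).re)))
      / (h (x 0) * Complex.normSq (z (x 0))) ^ 2)]
  · have hρ : (z (x 0) ^ 2 * w (x 0)).re ^ 2 + (z (x 0) ^ 2 * w (x 0)).im ^ 2 =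
        Complex.normSq (z (x 0)) ^ 2 * (1 - Complex.normSq (z (x 0))) := by
      have := H.normSq_add (x 0)
      rw [← eq_sub_iff_add_eq'] at this
      rw [← this, ← map_pow, ← map_mul, Complex.normSq_apply]
      ring
    have hEx := (hE (x 0)).ne'
    have hhx := (h0 (x 0)).ne'
    simp only [Pi.pow_apply]
    set E := Complex.normSq (z (x 0))
    set ρ := (z (x 0) ^ 2 * w (x 0)).re
    set σ := (z (x 0) ^ 2 * w (x 0)).im
    have hσ : σ ^ 2 = E ^ 2 * (1 - E) - ρ ^ 2 := by linarith
    rw [hσ]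
    field_simp
    push_cast
    ring
  · refine ((H.hasDerivAt_re (x 0)).div ((hh (x 0)).mul (hE' (x 0)))
      (mul_pos (h0 _) (hE _)).ne').congr_of_eventuallyEq (Filter.Eventually.of_forall fun s => ?_)
    have := (hE s).ne'
    have := (h0 s).ne'
    simp only [Pi.div_apply, Pi.mul_apply]
    field_simp

/-- The trace `gⁱʲ∂ᵢ∂ⱼu` equals `-2u` plus a multiple of `∂₀u`, which the normal projection kills.
-/
lemma meanCurvature_surface (H : IsProfile z w h) (x : Plane) :
    meanCurvature (surface z w) x = 0 := by
  have hE := (H.normSq_z_pos (x 0)).ne'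
  have h0 := (H.h_pos (x 0)).ne'
  have hinv : (firstForm (surface z w) x)⁻¹ =
      !![(h (x 0) ^ 2 * Complex.normSq (z (x 0)))⁻¹, 0; 0, (Complex.normSq (z (x 0)))⁻¹] := by
    rw [H.firstForm_surface]
    exact inv_diagonal (mul_ne_zero (pow_ne_zero 2 h0) hE) hE
  set S := Submodule.span ℝ {surface z w x, pd 0 (surface z w) x, pd 1 (surface z w) x}
  have key : (h (x 0) ^ 2 * Complex.normSq (z (x 0)))⁻¹ • pd 0 (pd 0 (surface z w)) x
      + (Complex.normSq (z (x 0)))⁻¹ • pd 1 (pd 1 (surface z w)) x =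
      ((h (x 0) ^ 3 * Complex.normSq (z (x 0)))⁻¹ * deriv h (x 0)) • pd 0 (surface z w) x
        - (2 : ℝ) • surface z w x := by
    have hneg : vec (z (x 0) * -Real.cos (x 1)) (z (x 0) * -Real.sin (x 1)) 0 =
        -vec (z (x 0) * Real.cos (x 1)) (z (x 0) * Real.sin (x 1)) 0 := by
      refine vec_ext ?_ ?_ ?_ <;> simp
    rw [H.pd_zero_pd_zero_surface, H.pd_one_pd_one_surface, H.pd_zero_surface, hneg]
    match_scalars <;> field_simp
    ring
  have hmem : (h (x 0) ^ 2 * Complex.normSq (z (x 0)))⁻¹ • pd 0 (pd 0 (surface z w)) x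
      + (Complex.normSq (z (x 0)))⁻¹ • pd 1 (pd 1 (surface z w)) x ∈ Sᗮᗮ := by
    refine Submodule.le_orthogonal_orthogonal S ?_
    rw [key]
    exact S.sub_mem (S.smul_mem _ (Submodule.subset_span (by simp)))
      (S.smul_mem _ (Submodule.subset_span (by simp)))
  have h3 := (Submodule.starProjection_apply_eq_zero_iff (K := Sᗮ)).2 hmem
  rw [map_add, map_smul, map_smul] at h3
  rw [meanCurvature, hinv]
  simp only [Fin.sum_univ_two, secondForm]
  rw [smul_eq_zero]
  right
  simpa using h3

/-- The contributions of `z` and `w` to the Hermitian product of `u` and `∂₀u` are `∓h conj(z²w)`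
and cancel; for `∂₁u` the product is already zero. -/
lemma omega_surface (H : IsProfile z w h) (x v : Plane) :
    omega (surface z w x) (fderiv ℝ (surface z w) x v) = 0 := by
  rw [fderiv_eq_pd, H.pd_zero_surface, H.pd_one_surface]
  simp [omega, surface, Fin.sum_univ_three, pow_two, -Complex.ofReal_cos, -Complex.ofReal_sin]
  linear_combination v 0 * h (x 0) * (2 * (z (x 0)).re * (z (x 0)).im * (w (x 0)).re
    + ((z (x 0)).re ^ 2 - (z (x 0)).im ^ 2) * (w (x 0)).im) * Real.cos_sq_add_sin_sq (x 1)

lemma fderiv_surface_injective (H : IsProfile z w h) (x : Plane) :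
    Function.Injective (fderiv ℝ (surface z w) x) := by
  refine (injective_iff_map_eq_zero _).2 fun v hv => ?_
  have hg := congrFun H.firstForm_surface x
  have h0 : inner ℝ (pd 0 (surface z w) x) (fderiv ℝ (surface z w) x v) = 0 := by simp [hv]
  have h1 : inner ℝ (pd 1 (surface z w) x) (fderiv ℝ (surface z w) x v) = 0 := by simp [hv]
  rw [fderiv_eq_pd, inner_add_right, inner_smul_right, inner_smul_right] at h0 h1
  have g00 := congrFun (congrFun hg 0) 0
  have g01 := congrFun (congrFun hg 0) 1
  have g10 := congrFun (congrFun hg 1) 0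
  have g11 := congrFun (congrFun hg 1) 1
  simp only [firstForm, Matrix.of_apply] at g00 g01 g10 g11
  rw [g00, g01] at h0
  rw [g10, g11] at h1
  have hE := (H.normSq_z_pos (x 0)).ne'
  have hh := (H.h_pos (x 0)).ne'
  ext i
  fin_cases i
  · simpa [hE, hh, H.z_ne] using h0
  · simpa [hE, hh, H.z_ne] using h1

end IsProfile

/-! ### Descent from the plane to the torus -/

/-- A smooth section of the covering of the circle near `p₀`, as a function on the circle. -/
def angle (p₀ p : Circle) : ℝ := Complex.arg p₀ + Complex.arg (p * p₀⁻¹ : Circle)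

lemma exp_angle (p₀ p : Circle) : Circle.exp (angle p₀ p) = p := by
  rw [angle, Circle.exp_add, Circle.exp_arg, Circle.exp_arg]
  simp

lemma contMDiffAt_angle (p : Circle) : ContMDiffAt (𝓡 1) 𝓘(ℝ, ℝ) ∞ (angle p) p := by
  have : Fact (Module.finrank ℝ ℂ = 1 + 1) := ⟨Complex.finrank_real_complex⟩
  have h1 : ContMDiffAt (𝓡 1) 𝓘(ℝ, ℂ) ∞ (fun q : Circle => ((q * p⁻¹ : Circle) : ℂ)) p :=
    (contMDiff_coe_sphere (E := ℂ) (n := 1)).contMDiffAt.comp p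
      (contMDiff_id.mul contMDiff_const : ContMDiff (𝓡 1) (𝓡 1) ∞ fun q : Circle => q * p⁻¹
        ).contMDiffAt
  -- Dividing by `p` moves the base point to `1`, away from the cut of the logarithm.
  have h2 : ContDiffAt ℝ ∞ (fun ζ : ℂ => Complex.arg p + ζ.arg) ((p * p⁻¹ : Circle) : ℂ) := by
    refine contDiffAt_const.add ?_
    have h3 : ContDiffAt ℝ ∞ Complex.log ((p * p⁻¹ : Circle) : ℂ) :=
      (Complex.contDiffAt_log (by simp)).restrict_scalars ℝ
    have h4 := Complex.imCLM.contDiff.contDiffAt.comp _ h3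
    refine h4.congr_of_eventuallyEq (Filter.Eventually.of_forall fun ζ => ?_)
    simp [Complex.log_im]
  exact ContMDiffAt.comp (g := fun ζ : ℂ => Complex.arg p + ζ.arg) p h2.contMDiffAt h1

/-- A smooth section of the covering of the torus near `p₀`, as a function on the torus. -/
def angles (p₀ p : Torus) : Plane := ![angle p₀.1 p.1, angle p₀.2 p.2]

lemma contMDiffAt_angles (p : Torus) : ContMDiffAt torusModel 𝓘(ℝ, Plane) ∞ (angles p) p := by
  refine contMDiffAt_pi_space.2 fun i => ?_
  fin_cases i
  · exact (contMDiffAt_angle p.1).comp p contMDiffAt_fst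
  · exact (contMDiffAt_angle p.2).comp p contMDiffAt_snd

/-- The differential of the covering map is a left inverse. -/
lemma mfderiv_angles_injective (p : Torus) :
    Function.Injective (mfderiv torusModel 𝓘(ℝ, Plane) (angles p) p) := by
  have h0 : ContMDiff 𝓘(ℝ, Plane) 𝓘(ℝ, ℝ) ∞ fun x : Plane => x 0 :=
    (contDiff_apply ℝ ℝ 0).contMDiff
  have h1 : ContMDiff 𝓘(ℝ, Plane) 𝓘(ℝ, ℝ) ∞ fun x : Plane => x 1 :=
    (contDiff_apply ℝ ℝ 1).contMDiff
  have hE : ContMDiff 𝓘(ℝ, Plane) torusModel ∞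
      fun x : Plane => ((Circle.exp (x 0), Circle.exp (x 1)) : Torus) :=
    (contMDiff_circleExp.comp h0).prodMk (contMDiff_circleExp.comp h1)
  have hid : (fun x : Plane => ((Circle.exp (x 0), Circle.exp (x 1)) : Torus)) ∘ angles p = id := by
    ext q <;> simp [angles, exp_angle]
  have hc := mfderiv_comp p (hE.contMDiffAt.mdifferentiableAt (by simp))
    ((contMDiffAt_angles p).mdifferentiableAt (by simp))
  rw [hid, mfderiv_id] at hc
  refine Function.LeftInverse.injective (g := mfderiv 𝓘(ℝ, Plane) torusModel
    (fun x : Plane => ((Circle.exp (x 0), Circle.exp (x 1)) : Torus)) (angles p p)) fun v => ?_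
  exact (DFunLike.congr_fun hc v).symm

section descend

variable {F : Plane → C3} {f : Torus → S5}

/-- This holds on the whole torus, since `angles p` is a set-theoretic section everywhere; only its
smoothness is local. -/
lemma coe_comp_eq (hf : ∀ x, lift f x = F x) (p : Torus) :
    (fun q => (f q : C3)) = F ∘ angles p := by
  ext1 q
  rw [Function.comp_apply, ← hf, lift]
  simp [angles, exp_angle]

lemma contMDiff_of_lift (hF : ContDiff ℝ ∞ F) (hf : ∀ x, lift f x = F x) :
    ContMDiff torusModel (𝓡 5) ∞ f := by
  have h : ContMDiff torusModel 𝓘(ℝ, C3) ∞ fun q => (f q : C3) := by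
    intro p
    rw [coe_comp_eq hf p]
    exact hF.contMDiff.contMDiffAt.comp p (contMDiffAt_angles p)
  exact h.codRestrict_sphere fun p => (f p).2

lemma mfderiv_of_lift (hF : ContDiff ℝ ∞ F) (hf : ∀ x, lift f x = F x) (p : Torus)
    (v : TangentSpace torusModel p) :
    mfderiv torusModel 𝓘(ℝ, C3) (fun q => (f q : C3)) p v =
      fderiv ℝ F (angles p p) (mfderiv torusModel 𝓘(ℝ, Plane) (angles p) p v) := by
  rw [coe_comp_eq hf p, mfderiv_comp p (hF.contMDiff.contMDiffAt.mdifferentiableAt (by simp))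
    ((contMDiffAt_angles p).mdifferentiableAt (by simp)), mfderiv_eq_fderiv]
  rfl

lemma mfderiv_injective_of_lift (hF : ContDiff ℝ ∞ F) (hf : ∀ x, lift f x = F x)
    (hi : ∀ x, Function.Injective (fderiv ℝ F x)) (p : Torus) :
    Function.Injective (mfderiv torusModel (𝓡 5) f p) := by
  have h1 : Function.Injective (mfderiv torusModel 𝓘(ℝ, C3) (fun q => (f q : C3)) p) := by
    intro v w hvw
    rw [mfderiv_of_lift hF hf, mfderiv_of_lift hF hf] at hvw
    exact mfderiv_angles_injective p (hi _ hvw)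
  have hc := mfderiv_comp p
    ((contMDiff_coe_sphere (E := C3) (n := 5) (m := ∞)).contMDiffAt.mdifferentiableAt (by simp)
      (x := f p)) ((contMDiff_of_lift hF hf).contMDiffAt.mdifferentiableAt (by simp))
  intro v w hvw
  refine h1 ?_
  have : (fun q => (f q : C3)) = Subtype.val ∘ f := rfl
  rw [this, hc]
  exact congrArg (mfderiv (𝓡 5) 𝓘(ℝ, C3) (Subtype.val : S5 → C3) (f p)) hvw

end descend

/-- The descent of a doubly periodic surface in `S⁵` to the torus. -/
def ofPlane (F : Plane → C3) (hF : ∀ x, ‖F x‖ = 1) (p : Torus) : S5 :=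
  ⟨F ![Complex.arg p.1, Complex.arg p.2], by simp [hF]⟩

lemma exists_arg_exp (x : ℝ) : ∃ n : ℤ, Complex.arg (Circle.exp x) = x + n * (2 * Real.pi) :=
  Circle.exp_eq_exp.1 (Circle.exp_arg _)

namespace IsProfile

variable {z w : ℝ → ℂ} {h : ℝ → ℝ}

lemma lift_ofPlane (H : IsProfile z w h) (hz : Function.Periodic z (2 * Real.pi))
    (hw : Function.Periodic w (2 * Real.pi)) (x : Plane) :
    lift (ofPlane (surface z w) H.norm_surface) x = surface z w x := by
  obtain ⟨m, hm⟩ := exists_arg_exp (x 0)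
  obtain ⟨n, hn⟩ := exists_arg_exp (x 1)
  simp only [lift, ofPlane, surface, hm, hn, Matrix.cons_val_zero, Matrix.cons_val_one,
    hz.int_mul m (x 0), hw.int_mul m (x 0), Real.cos_add_int_mul_two_pi,
    Real.sin_add_int_mul_two_pi]

/-- The sum of squares of the first two coordinates is `z²`. No more than `z²` and `w` can be
recovered at first, because rotation by `π` replaces `z` by `-z`. -/
lemma surface_injective (H : IsProfile z w h) {x y : Plane}
    (hinj : ∀ s s', w s = w s' → z s ^ 2 = z s' ^ 2 → Circle.exp s = Circle.exp s')
    (hz : Function.Periodic z (2 * Real.pi))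
    (hxy : surface z w x = surface z w y) :
    Circle.exp (x 0) = Circle.exp (y 0) ∧ Circle.exp (x 1) = Circle.exp (y 1) := by
  have e0 : z (x 0) * Real.cos (x 1) = z (y 0) * Real.cos (y 1) := congrArg (fun v : C3 => v 0) hxy
  have e1 : z (x 0) * Real.sin (x 1) = z (y 0) * Real.sin (y 1) := congrArg (fun v : C3 => v 1) hxy
  have e2 : w (x 0) = w (y 0) := congrArg (fun v : C3 => v 2) hxy
  have hx : (Real.cos (x 1) : ℂ) ^ 2 + (Real.sin (x 1) : ℂ) ^ 2 = 1 := by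
    exact_mod_cast Real.cos_sq_add_sin_sq (x 1)
  have hy : (Real.cos (y 1) : ℂ) ^ 2 + (Real.sin (y 1) : ℂ) ^ 2 = 1 := by
    exact_mod_cast Real.cos_sq_add_sin_sq (y 1)
  have h2 : z (x 0) ^ 2 = z (y 0) ^ 2 := by
    linear_combination (z (x 0) * Real.cos (x 1) + z (y 0) * Real.cos (y 1)) * e0
      + (z (x 0) * Real.sin (x 1) + z (y 0) * Real.sin (y 1)) * e1
      - z (x 0) ^ 2 * hx + z (y 0) ^ 2 * hy
  have h0 := hinj _ _ e2 h2
  refine ⟨h0, ?_⟩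
  obtain ⟨m, hm⟩ := Circle.exp_eq_exp.1 h0
  have hz0 : z (x 0) = z (y 0) := by rw [hm, hz.int_mul m (y 0)]
  rw [hz0] at e0 e1
  have hc := mul_left_cancel₀ (H.z_ne _) e0
  have hs := mul_left_cancel₀ (H.z_ne _) e1
  ext
  rw [Circle.coe_exp, Circle.coe_exp, Complex.exp_mul_I, Complex.exp_mul_I,
    ← Complex.ofReal_cos, ← Complex.ofReal_sin, ← Complex.ofReal_cos, ← Complex.ofReal_sin, hc, hs]

lemma isSmoothlyEmbedded (H : IsProfile z w h) (hz : Function.Periodic z (2 * Real.pi))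
    (hw : Function.Periodic w (2 * Real.pi))
    (hinj : ∀ s s', w s = w s' → z s ^ 2 = z s' ^ 2 → Circle.exp s = Circle.exp s') :
    IsSmoothlyEmbedded (ofPlane (surface z w) H.norm_surface) where
  smooth := contMDiff_of_lift H.contDiff_surface (H.lift_ofPlane hz hw)
  immersion := mfderiv_injective_of_lift H.contDiff_surface (H.lift_ofPlane hz hw)
    H.fderiv_surface_injective
  embedding := by
    refine ((contMDiff_of_lift H.contDiff_surface
      (H.lift_ofPlane hz hw)).continuous.isClosedEmbedding fun p q hpq => ?_).isEmbedding
    have := H.surface_injective hinj hz (congrArg Subtype.val hpq)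
    simp only [Matrix.cons_val_zero, Matrix.cons_val_one, Circle.exp_arg] at this
    exact Prod.ext this.1 this.2

lemma isLegendrian (H : IsProfile z w h) (hz : Function.Periodic z (2 * Real.pi))
    (hw : Function.Periodic w (2 * Real.pi)) :
    IsLegendrian (ofPlane (surface z w) H.norm_surface) := by
  intro p v
  have h1 : ((ofPlane (surface z w) H.norm_surface p : S5) : C3) = surface z w (angles p p) :=
    congrFun (coe_comp_eq (H.lift_ofPlane hz hw) p) p
  rw [mfderiv_of_lift H.contDiff_surface (H.lift_ofPlane hz hw), h1]
  exact H.omega_surface _ _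

lemma isMinimal (H : IsProfile z w h) (hz : Function.Periodic z (2 * Real.pi))
    (hw : Function.Periodic w (2 * Real.pi)) :
    IsMinimal (ofPlane (surface z w) H.norm_surface) := by
  intro x
  rw [funext (H.lift_ofPlane hz hw)]
  exact H.meanCurvature_surface x

lemma gaussCurvature_eq (H : IsProfile z w h) (hz : Function.Periodic z (2 * Real.pi))
    (hw : Function.Periodic w (2 * Real.pi)) (p : Torus) :
    gaussCurvature (ofPlane (surface z w) H.norm_surface) p =
      1 - 2 * (z (Complex.arg p.1) ^ 2 * w (Complex.arg p.1)).im ^ 2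
        / Complex.normSq (z (Complex.arg p.1)) ^ 3 := by
  rw [gaussCurvature, funext (H.lift_ofPlane hz hw), H.metricCurvature_surface]
  rfl

end IsProfile

/-- This turns the period `2πq` of the closed curve into `2π`. -/
lemma IsProfile.rescale {z w : ℝ → ℂ} {h : ℝ → ℝ} (H : IsProfile z w h) {q : ℝ} (hq : 0 < q) :
    IsProfile (fun s => z (q * s)) (fun s => w (q * s)) (fun s => q * h (q * s)) where
  contDiff_z := H.contDiff_z.comp (contDiff_const.mul contDiff_id)
  contDiff_w := H.contDiff_w.comp (contDiff_const.mul contDiff_id)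
  contDiff_h := contDiff_const.mul (H.contDiff_h.comp (contDiff_const.mul contDiff_id))
  h_pos s := mul_pos hq (H.h_pos _)
  z_ne s := H.z_ne _
  normSq_add s := H.normSq_add _
  deriv_z s := by
    have := (H.deriv_z (q * s)).scomp s ((hasDerivAt_id' s).const_mul q)
    refine this.congr_deriv ?_
    simp [mul_assoc]
  deriv_w s := by
    have := (H.deriv_w (q * s)).scomp s ((hasDerivAt_id' s).const_mul q)
    refine this.congr_deriv ?_
    simp [mul_assoc]

/-! ### The explicit profile curve -/

/-- The speed of the argument of the first coordinate of the explicit profile curve. -/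
def rate (k x : ℝ) : ℝ :=
  (1 - k ^ 2) / (2 * (1 + k * Real.cos x) * √(3 - k ^ 2 + 2 * k * Real.cos x))

/-- The argument of the first coordinate of the explicit profile curve. -/
def rot (k x : ℝ) : ℝ := ∫ t in (0 : ℝ)..x, rate k t

/-- The unit complex number with argument `rot k x`. -/
def phase (k x : ℝ) : ℂ := Complex.exp (rot k x * Complex.I)

/-- The first coordinate of the explicit profile curve. -/
def curveZ (k x : ℝ) : ℂ := (√(2 * (1 + k * Real.cos x) / (3 + k ^ 2)) : ℝ) * phase k x

/-- The second coordinate of the explicit profile curve. -/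
def curveW (k x : ℝ) : ℂ :=
  ((k * Real.sin x * √(3 - k ^ 2 + 2 * k * Real.cos x) : ℝ) + (1 - k ^ 2 : ℝ) * Complex.I) /
    (√(3 + k ^ 2) * (1 + k * Real.cos x) : ℝ) * conj (phase k x) ^ 2

/-- The speed factor of the explicit profile curve. -/
def speed (k x : ℝ) : ℝ := √(3 + k ^ 2) / (2 * √(3 - k ^ 2 + 2 * k * Real.cos x))

section

variable {k : ℝ}

lemma P_pos (h0 : 0 ≤ k) (h1 : k < 1) (x : ℝ) : 0 < 1 + k * Real.cos x := by
  nlinarith [Real.neg_one_le_cos x]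

lemma Q_pos (h0 : 0 ≤ k) (h1 : k < 1) (x : ℝ) : 0 < 3 - k ^ 2 + 2 * k * Real.cos x := by
  nlinarith [Real.neg_one_le_cos x]

lemma contDiff_P : ContDiff ℝ ∞ fun x => 1 + k * Real.cos x :=
  contDiff_const.add (contDiff_const.mul Real.contDiff_cos)

lemma contDiff_sqrt_Q (h0 : 0 ≤ k) (h1 : k < 1) :
    ContDiff ℝ ∞ fun x => √(3 - k ^ 2 + 2 * k * Real.cos x) :=
  (contDiff_const.add (contDiff_const.mul Real.contDiff_cos)).sqrt fun x => (Q_pos h0 h1 x).ne'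

lemma contDiff_rate (h0 : 0 ≤ k) (h1 : k < 1) : ContDiff ℝ ∞ (rate k) :=
  contDiff_const.div ((contDiff_const.mul contDiff_P).mul (contDiff_sqrt_Q h0 h1)) fun x =>
    (mul_pos (mul_pos two_pos (P_pos h0 h1 x)) (Real.sqrt_pos.2 (Q_pos h0 h1 x))).ne'

lemma hasDerivAt_rot (h0 : 0 ≤ k) (h1 : k < 1) (x : ℝ) : HasDerivAt (rot k) (rate k x) x :=
  (contDiff_rate h0 h1).continuous.integral_hasStrictDerivAt 0 x |>.hasDerivAt

lemma contDiff_rot (h0 : 0 ≤ k) (h1 : k < 1) : ContDiff ℝ ∞ (rot k) := by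
  refine contDiff_infty_iff_deriv.2 ⟨fun x => (hasDerivAt_rot h0 h1 x).differentiableAt, ?_⟩
  rw [funext fun x => (hasDerivAt_rot h0 h1 x).deriv]
  exact contDiff_rate h0 h1

lemma contDiff_phase (h0 : 0 ≤ k) (h1 : k < 1) : ContDiff ℝ ∞ (phase k) :=
  ((IsProfile.contDiff_ofReal_comp (contDiff_rot h0 h1)).mul contDiff_const).cexp

lemma hasDerivAt_phase (h0 : 0 ≤ k) (h1 : k < 1) (x : ℝ) :
    HasDerivAt (phase k) (phase k x * (rate k x * Complex.I)) x :=
  ((hasDerivAt_rot h0 h1 x).ofReal_comp.mul_const _).cexp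

lemma phase_mul_conj (x : ℝ) : phase k x * conj (phase k x) = 1 := by
  rw [phase, ← Complex.exp_conj, ← Complex.exp_add]
  simp

lemma normSq_phase (x : ℝ) : Complex.normSq (phase k x) = 1 := by
  have := phase_mul_conj (k := k) x
  rw [Complex.mul_conj] at this
  exact_mod_cast this

lemma normSq_curveZ (h0 : 0 ≤ k) (h1 : k < 1) (x : ℝ) :
    Complex.normSq (curveZ k x) = 2 * (1 + k * Real.cos x) / (3 + k ^ 2) := by
  have := P_pos h0 h1 x
  rw [curveZ, map_mul, normSq_phase, mul_one, Complex.normSq_ofReal,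
    Real.mul_self_sqrt (by positivity)]

lemma curveZ_sq (h0 : 0 ≤ k) (h1 : k < 1) (x : ℝ) :
    curveZ k x ^ 2 = (2 * (1 + k * Real.cos x) / (3 + k ^ 2) : ℝ) * phase k x ^ 2 := by
  have := P_pos h0 h1 x
  rw [curveZ, mul_pow, ← Complex.ofReal_pow, Real.sq_sqrt (by positivity)]

lemma normSq_curveW (h0 : 0 ≤ k) (h1 : k < 1) (x : ℝ) :
    Complex.normSq (curveW k x) = (1 + k ^ 2 - 2 * k * Real.cos x) / (3 + k ^ 2) := by
  have hP := (P_pos h0 h1 x).ne'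
  have hQ := Real.sq_sqrt (Q_pos h0 h1 x).le
  have hD := Real.sq_sqrt (show 0 ≤ 3 + k ^ 2 by positivity)
  have hD' : 3 + k ^ 2 ≠ 0 := by positivity
  rw [curveW, map_mul, map_div₀, map_pow, Complex.normSq_conj, normSq_phase,
    Complex.normSq_ofReal, Complex.normSq_add_mul_I, ← pow_two, mul_pow, mul_pow, mul_pow, hQ,
    hD]
  field_simp
  linear_combination (k ^ 2 * (3 - k ^ 2 + 2 * k * Real.cos x)) * Real.sin_sq_add_cos_sq x

/-- The phases cancel, and the imaginary part is the conserved quantity, independent of `x`. -/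
lemma curveZ_sq_mul_curveW (h0 : 0 ≤ k) (h1 : k < 1) (x : ℝ) :
    curveZ k x ^ 2 * curveW k x =
      ((2 / (3 + k ^ 2) / √(3 + k ^ 2) : ℝ) : ℂ) *
        ((k * Real.sin x * √(3 - k ^ 2 + 2 * k * Real.cos x) : ℝ) +
          (1 - k ^ 2 : ℝ) * Complex.I) := by
  have hP : ((1 + k * Real.cos x : ℝ) : ℂ) ≠ 0 := by exact_mod_cast (P_pos h0 h1 x).ne'
  have hD : ((√(3 + k ^ 2) : ℝ) : ℂ) ≠ 0 := by
    exact_mod_cast (Real.sqrt_pos.2 (show 0 < 3 + k ^ 2 by positivity)).ne'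
  have hD' : ((3 + k ^ 2 : ℝ) : ℂ) ≠ 0 := by
    exact_mod_cast (show 0 < 3 + k ^ 2 by positivity).ne'
  have hu := phase_mul_conj (k := k) x
  have hu2 : phase k x ^ 2 * conj (phase k x) ^ 2 = 1 := by rw [← mul_pow, hu, one_pow]
  rw [curveZ_sq h0 h1, curveW]
  generalize ((k * Real.sin x * √(3 - k ^ 2 + 2 * k * Real.cos x) : ℝ) : ℂ) +
    (1 - k ^ 2 : ℝ) * Complex.I = N
  simp only [Complex.ofReal_div, Complex.ofReal_mul]
  field_simp
  linear_combination N * hu2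

/-- Since `z'/z = -h conj(z²w)/|z|²`, the real part fixes `speed` and the imaginary part fixes
`rate`. -/
lemma isProfile_curve (h0 : 0 ≤ k) (h1 : k < 1) : IsProfile (curveZ k) (curveW k) (speed k) where
  contDiff_z := by
    refine (IsProfile.contDiff_ofReal_comp
      (((contDiff_const.mul contDiff_P).div_const _).sqrt fun x => ?_)).mul (contDiff_phase h0 h1)
    have := P_pos h0 h1 x
    positivity
  contDiff_w := by
    refine ((((IsProfile.contDiff_ofReal_comp ((contDiff_const.mul Real.contDiff_sin).mul
      (contDiff_sqrt_Q h0 h1))).add contDiff_const).mul ((IsProfile.contDiff_ofReal_comp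
        (contDiff_const.mul contDiff_P)).inv fun x => ?_))).mul
      ((IsProfile.contDiff_conj (contDiff_phase h0 h1)).pow 2)
    have := P_pos h0 h1 x
    exact_mod_cast (show 0 < √(3 + k ^ 2) * (1 + k * Real.cos x) by positivity).ne'
  contDiff_h := contDiff_const.div (contDiff_const.mul (contDiff_sqrt_Q h0 h1)) fun x =>
    (mul_pos two_pos (Real.sqrt_pos.2 (Q_pos h0 h1 x))).ne'
  h_pos x := by
    have := Q_pos h0 h1 x
    unfold speed
    positivity
  z_ne x := by
    have := P_pos h0 h1 x
    rw [← Complex.normSq_pos, normSq_curveZ h0 h1]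
    positivity
  normSq_add x := by
    have : 3 + k ^ 2 ≠ 0 := by positivity
    rw [normSq_curveZ h0 h1, normSq_curveW h0 h1]
    field_simp
    ring
  deriv_z x := by
    have hP := P_pos h0 h1 x
    have hQ := Real.sqrt_pos.2 (Q_pos h0 h1 x)
    have hD : 0 < √(3 + k ^ 2) := by positivity
    have ha : 0 < √(2 * (1 + k * Real.cos x) / (3 + k ^ 2)) := by positivity
    have hd : HasDerivAt (fun x => √(2 * (1 + k * Real.cos x) / (3 + k ^ 2)))
        (-√(2 * (1 + k * Real.cos x) / (3 + k ^ 2)) * k * Real.sin x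
          / (2 * (1 + k * Real.cos x))) x := by
      have h3 := (((((Real.hasDerivAt_cos x).const_mul k).const_add 1).const_mul 2).div_const
        (3 + k ^ 2)).sqrt (by positivity)
      refine h3.congr_deriv ?_
      have := Real.sq_sqrt (show 0 ≤ 2 * (1 + k * Real.cos x) / (3 + k ^ 2) by positivity)
      set a := √(2 * (1 + k * Real.cos x) / (3 + k ^ 2))
      field_simp
      rw [this]
      field_simp
    refine (hd.ofReal_comp.mul (hasDerivAt_phase h0 h1 x)).congr_deriv ?_
    have hu := phase_mul_conj (k := k) x
    simp only [curveZ, curveW, speed, rate, map_mul, map_div₀, map_add, map_pow,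
      Complex.conj_ofReal, Complex.conj_conj, Complex.conj_I]
    set u := phase k x
    set a := √(2 * (1 + k * Real.cos x) / (3 + k ^ 2))
    set P := 1 + k * Real.cos x
    set SQ := √(3 - k ^ 2 + 2 * k * Real.cos x)
    set SD := √(3 + k ^ 2)
    have hP' : (P : ℂ) ≠ 0 := by exact_mod_cast hP.ne'
    have hQ' : (SQ : ℂ) ≠ 0 := by exact_mod_cast hQ.ne'
    have hD' : (SD : ℂ) ≠ 0 := by exact_mod_cast hD.ne'
    push_cast
    have e : ∀ N : ℂ, (SD : ℂ) / (2 * SQ) * -(a * conj u * (N / (SD * P) * u ^ 2)) =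
        -(SD : ℂ) / (2 * SQ) * (a * (N / (SD * P) * u)) := fun N => by
      linear_combination (-(SD : ℂ) / (2 * SQ) * (a * (N / (SD * P) * u))) * hu
    rw [e]
    field_simp
    ring
  deriv_w x := by
    have hP := P_pos h0 h1 x
    have hQ := Real.sqrt_pos.2 (Q_pos h0 h1 x)
    have hD : 0 < √(3 + k ^ 2) := by positivity
    have hSQ : HasDerivAt (fun x => √(3 - k ^ 2 + 2 * k * Real.cos x))
        (-k * Real.sin x / √(3 - k ^ 2 + 2 * k * Real.cos x)) x := by
      have h3 := (((Real.hasDerivAt_cos x).const_mul (2 * k)).const_add (3 - k ^ 2)).sqrt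
        (Q_pos h0 h1 x).ne'
      refine h3.congr_deriv ?_
      field_simp
    have hN := ((((Real.hasDerivAt_sin x).const_mul k).mul hSQ).ofReal_comp.add_const
      (((1 - k ^ 2 : ℝ) : ℂ) * Complex.I)).div
      ((((Real.hasDerivAt_cos x).const_mul k).const_add 1).const_mul √(3 + k ^ 2)).ofReal_comp
        (by exact_mod_cast (mul_pos hD hP).ne')
    refine (hN.mul ((IsProfile.hasDerivAt_conj (hasDerivAt_phase h0 h1 x)).pow 2)).congr_deriv ?_
    have hz := congrArg conj (curveZ_sq h0 h1 x)
    rw [map_pow, map_mul, map_pow, Complex.conj_ofReal] at hz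
    rw [hz]
    have hQQ := Real.sq_sqrt (Q_pos h0 h1 x).le
    have hDD := Real.sq_sqrt (show 0 ≤ 3 + k ^ 2 by positivity)
    have hsc := Real.sin_sq_add_cos_sq x
    simp only [speed, rate, map_mul, Complex.conj_ofReal, Complex.conj_I, Pi.div_apply, Pi.mul_apply,
      Pi.pow_apply]
    generalize conj (phase k x) = v
    generalize √(3 - k ^ 2 + 2 * k * Real.cos x) = SQ at *
    generalize √(3 + k ^ 2) = SD at *
    generalize Real.cos x = c at *
    generalize Real.sin x = s at *
    rw [← hDD]
    have hP' : (1 + k * c : ℂ) ≠ 0 := by exact_mod_cast hP.ne'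
    have hQ' : (SQ : ℂ) ≠ 0 := by exact_mod_cast hQ.ne'
    have hD' : (SD : ℂ) ≠ 0 := by exact_mod_cast hD.ne'
    have hQQ' : (SQ : ℂ) ^ 2 = 3 - k ^ 2 + 2 * k * c := by exact_mod_cast hQQ
    have hsc' : (s : ℂ) ^ 2 + c ^ 2 = 1 := by exact_mod_cast hsc
    push_cast
    field_simp
    linear_combination (k * c * (1 + k * c) + k ^ 2 * s ^ 2) * v ^ 2 * hQQ'
      + (k ^ 2 * (3 - k ^ 2 + 2 * k * c) - k ^ 2 * (1 + k * c)) * v ^ 2 * hsc'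
      - (1 - (k : ℂ) ^ 2) ^ 2 * v ^ 2 * Complex.I_sq

end

/-! ### The rotation number -/

/-- This is the bound of `rate_le`, squared and cleared of denominators. The Taylor expansion of
`2√3 · rate` has `-20/24` in place of `-19/24`; the slack `k²/24` absorbs the terms of order `k³`
when `k ≤ 1/100`. -/
lemma rate_polynomial_bound {k c : ℝ} (h0 : 0 ≤ k) (h1 : k ≤ 1 / 100) (hc : |c| ≤ 1) :
    3 * (1 - k ^ 2) ^ 2 ≤ ((1 - 4 / 3 * k * c + k ^ 2 * (3 / 2 * c ^ 2 - 19 / 24)) * (1 + k * c)) ^ 2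
      * (3 - k ^ 2 + 2 * k * c) := by
  obtain ⟨c1, c2⟩ := abs_le.1 hc
  have cc : c ^ 2 ≤ 1 := by nlinarith
  have k2 : 0 ≤ k ^ 2 := by positivity
  have k3 : 0 ≤ k ^ 3 := by positivity
  have k3' : k ^ 3 ≤ k ^ 2 / 100 := by nlinarith
  have k4' : k ^ 4 ≤ k ^ 3 / 100 := by nlinarith
  have k4 : 0 ≤ k ^ 4 := by positivity
  have k5 : 0 ≤ k ^ 5 := by positivity
  have k2' : k ^ 2 ≤ 1 / 10000 := by nlinarith
  -- `L` is the product of the two factors up to order `k²`, less `k³` to cover its cubic term.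
  set L := 1 - k * c / 3 + k ^ 2 * (c ^ 2 / 6 - 19 / 24) - k ^ 3 with hL
  have hkc : |k * c| ≤ 1 / 100 := by
    rw [abs_mul, abs_of_nonneg h0]; nlinarith [abs_nonneg c]
  obtain ⟨kc1, kc2⟩ := abs_le.1 hkc
  have hL0 : 0 ≤ L := by
    have := mul_nonneg k2 (sq_nonneg c)
    rw [hL]
    linarith
  have hBP : L ≤ (1 - 4 / 3 * k * c + k ^ 2 * (3 / 2 * c ^ 2 - 19 / 24)) * (1 + k * c) := by
    have h : -1 ≤ c * (3 / 2 * c ^ 2 - 19 / 24) := by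
      nlinarith [mul_nonneg (sq_nonneg c) (by linarith : 0 ≤ 1 + c)]
    have := mul_le_mul_of_nonneg_left h k3
    rw [hL]
    linarith
  have hLL : 1 - 2 / 3 * (k * c) + k ^ 2 * (4 / 9 * c ^ 2 - 19 / 12) - 3 * k ^ 3 ≤ L ^ 2 := by
    set y := (c ^ 2 / 6 - 19 / 24) - k with hy
    have hy1 : |y| ≤ 1 := by rw [abs_le]; constructor <;> linarith [sq_nonneg c]
    have hcy : c * y ≤ 1 := (le_abs_self _).trans (by
      rw [abs_mul]; exact mul_le_one₀ hc (abs_nonneg _) hy1)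
    have := mul_le_mul_of_nonneg_left hcy k3
    have e : L ^ 2 - (1 - 2 / 3 * (k * c) + k ^ 2 * (4 / 9 * c ^ 2 - 19 / 12) - 3 * k ^ 3) =
      k ^ 3 - 2 / 3 * (k ^ 3 * (c * y)) + (k ^ 2 * y) ^ 2 := by rw [hL, hy]; ring
    linarith [sq_nonneg (k ^ 2 * y)]
  have hQ : 0 ≤ 3 - k ^ 2 + 2 * k * c := by linarith
  refine le_trans ?_ (mul_le_mul_of_nonneg_right (hLL.trans (pow_le_pow_left₀ hL0 hBP 2)) hQ)
  set u := 4 / 9 * c ^ 2 - 19 / 12 with hu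
  have hu1 : |u| ≤ 2 := by rw [abs_le]; constructor <;> linarith [sq_nonneg c]
  have hcu : -2 ≤ c * u := (abs_le.1 (by
    rw [abs_mul]
    exact (mul_le_of_le_one_left (abs_nonneg u) hc).trans hu1 : |c * u| ≤ 2)).1
  have t1 := mul_le_mul_of_nonneg_left hcu k3
  have t2 := mul_le_mul_of_nonneg_left c1 k3
  have t3 := mul_le_mul_of_nonneg_left c2 k4
  have t4 := mul_le_mul_of_nonneg_left (abs_le.1 hu1).2 k4
  have e : (1 - 2 / 3 * (k * c) + k ^ 2 * u - 3 * k ^ 3) * (3 - k ^ 2 + 2 * k * c) =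
      3 - 23 / 4 * k ^ 2 + 2 / 3 * (k ^ 3 * c) + 2 * (k ^ 3 * (c * u)) - 9 * k ^ 3 - k ^ 4 * u
        - 6 * (k ^ 4 * c) + 3 * k ^ 5 := by
    have : c ^ 2 = 9 / 4 * (u + 19 / 12) := by rw [hu]; ring
    linear_combination (-4 / 3 * k ^ 2) * this
  rw [e]
  linarith

lemma rate_le {k : ℝ} (h0 : 0 ≤ k) (h1 : k ≤ 1 / 100) (x : ℝ) :
    rate k x ≤ 1 / (2 * √3) * (1 - 4 / 3 * k * Real.cos x
      + k ^ 2 * (3 / 2 * Real.cos x ^ 2 - 19 / 24)) := by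
  have hk : k < 1 := by linarith
  have hP := P_pos h0 hk x
  have hQ := Q_pos h0 hk x
  have hb := rate_polynomial_bound h0 h1 (Real.abs_cos_le_one x)
  have hc1 := Real.cos_le_one x
  have hc2 := Real.neg_one_le_cos x
  unfold rate
  set c := Real.cos x
  set B := 1 - 4 / 3 * k * c + k ^ 2 * (3 / 2 * c ^ 2 - 19 / 24)
  have hB : 0 < B := by
    have h2 : k * c ≤ 1 / 100 := by nlinarith
    have h3 : k ^ 2 ≤ 1 / 10000 := by nlinarith
    have h4 := mul_nonneg (sq_nonneg k) (sq_nonneg c)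
    have h5 : B = 1 - 4 / 3 * (k * c) + 3 / 2 * (k ^ 2 * c ^ 2) - 19 / 24 * k ^ 2 := by ring
    linarith
  have key : √3 * (1 - k ^ 2) ≤ B * (1 + k * c) * √(3 - k ^ 2 + 2 * k * c) := by
    refine (abs_le_of_sq_le_sq' ?_ (by positivity)).2
    rw [mul_pow, mul_pow _ √_, Real.sq_sqrt (by norm_num), Real.sq_sqrt hQ.le]
    exact hb
  have h3 : 0 < √(3 : ℝ) := by positivity
  have hSQ := Real.sqrt_pos.2 hQ
  rw [div_mul_eq_mul_div, one_mul, div_le_div_iff₀ (by positivity) (by positivity)]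
  linarith

lemma rot_zero_two_pi : rot 0 (2 * Real.pi) = Real.pi / √3 := by
  simp [rot, rate]
  field_simp

/-- The rotation number of the explicit profile curve is not locally constant at `k = 0`. -/
lemma rot_two_pi_lt {k : ℝ} (h0 : 0 < k) (h1 : k ≤ 1 / 100) :
    rot k (2 * Real.pi) < Real.pi / √3 := by
  have hk : k < 1 := by linarith
  have hle : rot k (2 * Real.pi) ≤ ∫ x in (0 : ℝ)..(2 * Real.pi), 1 / (2 * √3) *
      (1 - 4 / 3 * k * Real.cos x + k ^ 2 * (3 / 2 * Real.cos x ^ 2 - 19 / 24)) :=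
    intervalIntegral.integral_mono_on (by positivity)
      ((contDiff_rate h0.le hk).continuous.intervalIntegrable _ _)
      ((by fun_prop : Continuous fun x => 1 / (2 * √3) * (1 - 4 / 3 * k * Real.cos x
        + k ^ 2 * (3 / 2 * Real.cos x ^ 2 - 19 / 24))).intervalIntegrable _ _)
      fun x _ => rate_le h0.le h1 x
  -- The mean of `cos²` is `1/2`, and `3/4 - 19/24 = -1/24` is still negative.
  have hint : ∫ x in (0 : ℝ)..(2 * Real.pi), 1 / (2 * √3) *
      (1 - 4 / 3 * k * Real.cos x + k ^ 2 * (3 / 2 * Real.cos x ^ 2 - 19 / 24)) =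
      Real.pi / √3 * (1 - k ^ 2 / 24) := by
    have e : ∀ x, 1 - 4 / 3 * k * Real.cos x + k ^ 2 * (3 / 2 * Real.cos x ^ 2 - 19 / 24) =
        (1 - 19 / 24 * k ^ 2) - 4 / 3 * k * Real.cos x + 3 / 2 * k ^ 2 * Real.cos x ^ 2 :=
      fun x => by ring
    simp only [e]
    have i1 : IntervalIntegrable (fun x => 4 / 3 * k * Real.cos x) MeasureTheory.volume 0
      (2 * Real.pi) := (by fun_prop : Continuous _).intervalIntegrable _ _
    have i2 : IntervalIntegrable (fun x => 3 / 2 * k ^ 2 * Real.cos x ^ 2) MeasureTheory.volume 0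
      (2 * Real.pi) := (by fun_prop : Continuous _).intervalIntegrable _ _
    rw [intervalIntegral.integral_const_mul, intervalIntegral.integral_add
      (intervalIntegrable_const.sub i1) i2, intervalIntegral.integral_sub intervalIntegrable_const
      i1, intervalIntegral.integral_const_mul, intervalIntegral.integral_const_mul, integral_cos,
      integral_cos_sq]
    simp
    field_simp
    ring
  rw [hint] at hle
  refine hle.trans_lt ?_
  have : 0 < Real.pi / √3 := by positivity
  nlinarith [pow_pos h0 2]

lemma continuousOn_rot_two_pi :
    ContinuousOn (fun k => rot k (2 * Real.pi)) (Set.Icc 0 (1 / 100)) := by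
  rw [continuousOn_iff_continuous_domRestrict]
  refine intervalIntegral.continuous_parametric_intervalIntegral_of_continuous' (f := fun
    (k : Set.Icc (0 : ℝ) (1 / 100)) x => rate k x) ?_ 0 (2 * Real.pi)
  refine Continuous.div (by fun_prop) (by fun_prop) fun p => ?_
  have hk : (p.1 : ℝ) < 1 := by linarith [p.1.2.2]
  exact (mul_pos (mul_pos two_pos (P_pos p.1.2.1 hk _))
    (Real.sqrt_pos.2 (Q_pos p.1.2.1 hk _))).ne'

/-- There are arbitrarily small `k` for which the profile curve closes up after an odd prime number
of oscillations, and after no smaller number of them. -/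
lemma exists_rot_eq {δ : ℝ} (hδ : 0 < δ) : ∃ k : ℝ, 0 < k ∧ k < 1 ∧ k < δ ∧ ∃ p q : ℕ,
    q.Prime ∧ 2 < q ∧ 0 < p ∧ p < q ∧ rot k (2 * Real.pi) = 2 * Real.pi * p / q := by
  set k₁ := min (1 / 100) (δ / 2) with hk₁
  have hk0 : 0 < k₁ := by positivity
  have hk1 : k₁ ≤ 1 / 100 := min_le_left _ _
  have hkδ : k₁ < δ := (min_le_right _ _).trans_lt (by linarith)
  have hlt := rot_two_pi_lt hk0 hk1
  set a := rot k₁ (2 * Real.pi)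
  have hpi := Real.pi_pos
  have ha : 0 ≤ a := intervalIntegral.integral_nonneg (by positivity) fun x _ => by
    have h1 := P_pos hk0.le (by linarith) x
    have h2 : 0 ≤ 1 - k₁ ^ 2 := by nlinarith
    unfold rate
    positivity
  -- Large enough that the spacing `2π/q` is smaller than the gap between `a` and `π/√3`.
  obtain ⟨q, hqN, hq⟩ := Nat.exists_infinite_primes
    (max 3 (⌈2 * Real.pi / (Real.pi / √3 - a)⌉₊ + 1))
  have hq3 : 3 ≤ q := (le_max_left _ _).trans hqN
  have hq0 : (0 : ℝ) < q := by exact_mod_cast (by omega : 0 < q)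
  have hqb : 2 * Real.pi / (Real.pi / √3 - a) < q :=
    (Nat.le_ceil _).trans_lt (by exact_mod_cast (le_max_right _ _).trans hqN)
  rw [div_lt_iff₀ (sub_pos.2 hlt)] at hqb
  -- Adding one makes `a < 2πp/q` strict and `p` positive.
  set p := ⌊q * a / (2 * Real.pi)⌋₊ + 1 with hp
  have h1 : q * a / (2 * Real.pi) < p := by rw [hp]; exact_mod_cast Nat.lt_floor_add_one _
  have h2 : (p : ℝ) ≤ q * a / (2 * Real.pi) + 1 := by
    rw [hp]; push_cast; linarith [Nat.floor_le (show 0 ≤ q * a / (2 * Real.pi) by positivity)]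
  have h3 : a < 2 * Real.pi * p / q := by
    rw [lt_div_iff₀ hq0]; rw [div_lt_iff₀ (by positivity)] at h1; linarith
  have h4 : 2 * Real.pi * p / q < Real.pi / √3 := by
    rw [div_lt_iff₀ hq0]
    have : 2 * Real.pi * p ≤ q * a + 2 * Real.pi := by
      refine (mul_le_mul_of_nonneg_left h2 (by positivity)).trans (le_of_eq ?_)
      field_simp
    linarith
  have h5 : p < q := by
    have hs : (1 : ℝ) ≤ √3 := Real.one_le_sqrt.2 (by norm_num)
    have h6 := h4.trans_le (div_le_self hpi.le hs)
    rw [div_lt_iff₀ hq0] at h6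
    have : (p : ℝ) < q := by nlinarith
    exact_mod_cast this
  have hcont : ContinuousOn (fun k => rot k (2 * Real.pi)) (Set.Icc 0 k₁) :=
    continuousOn_rot_two_pi.mono (Set.Icc_subset_Icc_right hk1)
  have hmem : 2 * Real.pi * p / q ∈ Set.Ioo (rot k₁ (2 * Real.pi)) (rot 0 (2 * Real.pi)) :=
    ⟨h3, by rwa [rot_zero_two_pi]⟩
  obtain ⟨k, hk, hkr⟩ := intermediate_value_Ioo' hk0.le hcont hmem
  exact ⟨k, hk.1, by linarith [hk.2], hk.2.trans hkδ, p, q, hq, by omega, by omega, h5, hkr⟩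

/-! ### Closing up and embeddedness -/

section

variable {k : ℝ}

lemma rot_add_int_mul (h0 : 0 ≤ k) (h1 : k < 1) (x : ℝ) (j : ℤ) :
    rot k (x + j * (2 * Real.pi)) = rot k x + j * rot k (2 * Real.pi) := by
  have hi : ∀ a b, IntervalIntegrable (rate k) MeasureTheory.volume a b := fun a b =>
    (contDiff_rate h0 h1).continuous.intervalIntegrable a b
  have hper : Function.Periodic (rate k) (2 * Real.pi) := fun x => by simp [rate]
  have hadd : ∀ x, rot k (x + 2 * Real.pi) = rot k x + rot k (2 * Real.pi) := by
    intro x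
    have := hper.intervalIntegral_add_eq x 0
    rw [zero_add] at this
    rw [rot, ← intervalIntegral.integral_add_adjacent_intervals (hi 0 x) (hi x _), this]
    rfl
  -- Subtracting the mean slope leaves a periodic function, so one period yields all integer
  -- multiples.
  have hg : Function.Periodic
      (fun x => rot k x - rot k (2 * Real.pi) / (2 * Real.pi) * x) (2 * Real.pi) := by
    intro x
    have := Real.pi_pos.ne'
    simp only [hadd]
    field_simp
    ring
  have h2 := hg.int_mul j x
  have h3 : rot k (2 * Real.pi) / (2 * Real.pi) * (x + j * (2 * Real.pi)) =
      rot k (2 * Real.pi) / (2 * Real.pi) * x + j * rot k (2 * Real.pi) := by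
    have := Real.pi_pos.ne'
    field_simp
  simp only [h3] at h2
  linarith

lemma phase_add_int_mul (h0 : 0 ≤ k) (h1 : k < 1) (x : ℝ) (j : ℤ) :
    phase k (x + j * (2 * Real.pi)) =
      phase k x * Complex.exp ((j * rot k (2 * Real.pi) : ℝ) * Complex.I) := by
  rw [phase, phase, rot_add_int_mul h0 h1, ← Complex.exp_add]
  push_cast
  ring_nf

/-- `|w|²` determines `cos x` and `Re(z²w)` then determines `sin x`, both because `k ≠ 0`; what
remains is the phase of `z²`. -/
lemma exists_int_of_curve_eq (h0 : 0 < k) (h1 : k < 1) {x y : ℝ}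
    (hw : curveW k x = curveW k y) (hz : curveZ k x ^ 2 = curveZ k y ^ 2) :
    ∃ j : ℤ, y = x + j * (2 * Real.pi) ∧
      Complex.exp ((2 * (j * rot k (2 * Real.pi)) : ℝ) * Complex.I) = 1 := by
  have hD : 0 < 3 + k ^ 2 := by positivity
  have hcos : Real.cos x = Real.cos y := by
    have h := congrArg Complex.normSq hw
    rw [normSq_curveW h0.le h1, normSq_curveW h0.le h1, div_left_inj' hD.ne'] at h
    have : k * (Real.cos x - Real.cos y) = 0 := by linarith
    rcases mul_eq_zero.1 this with h | h
    · exact absurd h h0.ne'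
    · linarith
  have hsin : Real.sin x = Real.sin y := by
    have h : curveZ k x ^ 2 * curveW k x = curveZ k y ^ 2 * curveW k y := by rw [hw, hz]
    rw [curveZ_sq_mul_curveW h0.le h1, curveZ_sq_mul_curveW h0.le h1, hcos] at h
    have hne : ((2 / (3 + k ^ 2) / √(3 + k ^ 2) : ℝ) : ℂ) ≠ 0 := by
      exact_mod_cast (show 0 < 2 / (3 + k ^ 2) / √(3 + k ^ 2) by positivity).ne'
    have h2 := add_right_cancel (mul_left_cancel₀ hne h)
    rw [Complex.ofReal_inj] at h2
    exact mul_left_cancel₀ h0.ne'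
      (mul_right_cancel₀ (Real.sqrt_pos.2 (Q_pos h0.le h1 y)).ne' h2)
  obtain ⟨j, hj⟩ := Real.Angle.angle_eq_iff_two_pi_dvd_sub.1
    (Real.Angle.cos_sin_inj hcos.symm hsin.symm)
  have hy : y = x + j * (2 * Real.pi) := by linarith
  refine ⟨j, hy, ?_⟩
  rw [curveZ_sq h0.le h1, curveZ_sq h0.le h1, hcos] at hz
  have hne : ((2 * (1 + k * Real.cos y) / (3 + k ^ 2) : ℝ) : ℂ) ≠ 0 := by
    have := P_pos h0.le h1 y
    exact_mod_cast (show 0 < 2 * (1 + k * Real.cos y) / (3 + k ^ 2) by positivity).ne'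
  have h2 := mul_left_cancel₀ hne hz
  rw [hy, phase_add_int_mul h0.le h1, mul_pow, ← Complex.exp_nat_mul] at h2
  have h3 : phase k x ^ 2 ≠ 0 := pow_ne_zero 2 (Complex.exp_ne_zero _)
  have h4 := mul_left_cancel₀ h3 ((mul_one _).trans h2)
  rw [h4]
  push_cast
  ring_nf

section closed

variable {p q : ℕ}

lemma phase_add (hrot : rot k (2 * Real.pi) = 2 * Real.pi * p / q)
    (h0 : 0 ≤ k) (h1 : k < 1) (hq : 0 < q) (x : ℝ) :
    phase k (x + q * (2 * Real.pi)) = phase k x := by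
  have h := phase_add_int_mul h0 h1 x q
  have hq' : (q : ℝ) ≠ 0 := by exact_mod_cast hq.ne'
  have e : ((((q : ℤ) : ℝ) * rot k (2 * Real.pi) : ℝ) : ℂ) * Complex.I =
      p * (2 * Real.pi * Complex.I) := by
    have : ((q : ℤ) : ℝ) * rot k (2 * Real.pi) = p * (2 * Real.pi) := by
      rw [hrot]; push_cast; field_simp
    rw [this]
    push_cast
    ring
  rw [e, Complex.exp_nat_mul_two_pi_mul_I, mul_one] at h
  exact_mod_cast h

lemma curveZ_periodic (hrot : rot k (2 * Real.pi) = 2 * Real.pi * p / q)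
    (h0 : 0 ≤ k) (h1 : k < 1) (hq : 0 < q) :
    Function.Periodic (fun s => curveZ k (q * s)) (2 * Real.pi) := by
  intro s
  simp only [mul_add, curveZ, phase_add hrot h0 h1 hq, Real.cos_add_nat_mul_two_pi]

lemma curveW_periodic (hrot : rot k (2 * Real.pi) = 2 * Real.pi * p / q)
    (h0 : 0 ≤ k) (h1 : k < 1) (hq : 0 < q) :
    Function.Periodic (fun s => curveW k (q * s)) (2 * Real.pi) := by
  intro s
  simp only [mul_add, curveW, phase_add hrot h0 h1 hq, Real.cos_add_nat_mul_two_pi,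
    Real.sin_add_nat_mul_two_pi]

/-- A coincidence `j` oscillations apart forces `q ∣ 2jp`, hence `q ∣ j`, as `q` is an odd prime and
`0 < p < q`. -/
lemma exp_eq_of_curve_eq (hrot : rot k (2 * Real.pi) = 2 * Real.pi * p / q)
    (h0 : 0 < k) (h1 : k < 1) (hq : q.Prime) (hq2 : 2 < q) (hp : 0 < p)
    (hpq : p < q) (s s' : ℝ) (hw : curveW k (q * s) = curveW k (q * s'))
    (hz : curveZ k (q * s) ^ 2 = curveZ k (q * s') ^ 2) : Circle.exp s = Circle.exp s' := by
  obtain ⟨j, hj, he⟩ := exists_int_of_curve_eq h0 h1 hw hz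
  have hq' : (q : ℝ) ≠ 0 := by exact_mod_cast hq.pos.ne'
  obtain ⟨n, hn⟩ := Complex.exp_eq_one_iff.1 he
  have h2 : (2 * (j * rot k (2 * Real.pi)) : ℝ) = n * (2 * Real.pi) := by
    have : ((2 * (j * rot k (2 * Real.pi)) : ℝ) : ℂ) * Complex.I =
        ((n * (2 * Real.pi) : ℝ) : ℂ) * Complex.I := by
      rw [hn]; push_cast; ring
    exact_mod_cast mul_right_cancel₀ Complex.I_ne_zero this
  have h3 : (j * (2 * p) : ℤ) = q * n := by
    rw [hrot] at h2
    have hpi := Real.pi_pos.ne'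
    field_simp at h2
    have : ((j * (2 * p) : ℤ) : ℝ) = ((q * n : ℤ) : ℝ) := by push_cast; linarith
    exact_mod_cast this
  have hqz : Prime (q : ℤ) := Nat.prime_iff_prime_int.1 hq
  have hdvd : (q : ℤ) ∣ j := by
    rcases hqz.dvd_or_dvd (Dvd.intro _ h3.symm) with h | h
    · exact h
    · exfalso
      rcases hqz.dvd_or_dvd h with h | h
      · have := Int.le_of_dvd (by norm_num) h
        omega
      · have := Int.le_of_dvd (by omega) h
        omega
  obtain ⟨m, rfl⟩ := hdvd
  refine (Circle.exp_eq_exp.2 ⟨m, ?_⟩).symm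
  refine mul_left_cancel₀ hq' (hj.trans ?_)
  push_cast
  ring

end closed

/-! ### Curvature of the explicit surface -/

/-- The Gauss curvature of the surface of revolution of the explicit profile curve. -/
lemma curvature_curve (h0 : 0 ≤ k) (h1 : k < 1) (x : ℝ) :
    1 - 2 * (curveZ k x ^ 2 * curveW k x).im ^ 2 / Complex.normSq (curveZ k x) ^ 3 =
      1 - (1 - k ^ 2) ^ 2 / (1 + k * Real.cos x) ^ 3 := by
  have hP := (P_pos h0 h1 x).ne'
  have hD : 3 + k ^ 2 ≠ 0 := by positivity
  have hDD := Real.sq_sqrt (show 0 ≤ 3 + k ^ 2 by positivity)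
  have him : (curveZ k x ^ 2 * curveW k x).im = 2 / (3 + k ^ 2) / √(3 + k ^ 2) * (1 - k ^ 2) := by
    rw [curveZ_sq_mul_curveW h0 h1, Complex.im_ofReal_mul, Complex.add_im, Complex.ofReal_im,
      Complex.im_ofReal_mul, Complex.I_im, mul_one, zero_add]
  rw [him, normSq_curveZ h0 h1, mul_pow, div_pow _ √_, hDD]
  field_simp

/-- The extremes occur at `cos x = ±1`. At `cos x = -1` the quotient is `(1 + k)²/(1 - k)`, which
equals `1 + 7k` at `k = 1/2`; hence the constant. -/
lemma abs_curvature_le (h0 : 0 ≤ k) (h1 : k ≤ 1 / 2) (x : ℝ) :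
    |1 - (1 - k ^ 2) ^ 2 / (1 + k * Real.cos x) ^ 3| ≤ 7 * k := by
  have hlo : 1 - k ≤ 1 + k * Real.cos x := by nlinarith [Real.neg_one_le_cos x]
  have hhi : 1 + k * Real.cos x ≤ 1 + k := by nlinarith [Real.cos_le_one x]
  have hP : 0 < 1 + k * Real.cos x := by linarith
  have l3 := pow_le_pow_left₀ (by linarith : 0 ≤ 1 - k) hlo 3
  have u3 := pow_le_pow_left₀ hP.le hhi 3
  rw [abs_le]
  constructor
  · have : (1 - k ^ 2) ^ 2 / (1 + k * Real.cos x) ^ 3 ≤ 1 + 7 * k := by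
      rw [div_le_iff₀ (by positivity)]
      refine le_trans ?_ (mul_le_mul_of_nonneg_left l3 (by linarith))
      have e : (1 + 7 * k) * (1 - k) ^ 3 - (1 - k ^ 2) ^ 2 =
        (1 - k) ^ 2 * (k * (4 - 8 * k)) := by ring
      have := mul_nonneg (sq_nonneg (1 - k)) (mul_nonneg h0 (by linarith : 0 ≤ 4 - 8 * k))
      linarith
    linarith
  · have : 1 - 7 * k ≤ (1 - k ^ 2) ^ 2 / (1 + k * Real.cos x) ^ 3 := by
      rw [le_div_iff₀ (by positivity)]
      rcases le_or_gt 0 (1 - 7 * k) with h | h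
      · refine (mul_le_mul_of_nonneg_left u3 h).trans ?_
        have e : (1 - k ^ 2) ^ 2 - (1 - 7 * k) * (1 + k) ^ 3 =
          (1 + k) ^ 2 * (k * (4 + 8 * k)) := by ring
        have := mul_nonneg (sq_nonneg (1 + k)) (mul_nonneg h0 (by linarith : 0 ≤ 4 + 8 * k))
        linarith
      · exact (mul_nonpos_of_nonpos_of_nonneg h.le (pow_pos hP 3).le).trans (sq_nonneg _)
    linarith

end

end LegendrianTorus

end

theorem mainTheorem7 (ε : ℝ) (hε : 0 < ε) :
    ∃ f : LegendrianTorus.Torus → LegendrianTorus.S5,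
      LegendrianTorus.IsSmoothlyEmbedded f ∧
      LegendrianTorus.IsLegendrian f ∧
      LegendrianTorus.IsMinimal f ∧
      ¬ LegendrianTorus.IsFlat f ∧
      BddAbove (Set.range fun p => |LegendrianTorus.gaussCurvature f p|) ∧
      (⨆ p, |LegendrianTorus.gaussCurvature f p|) < ε := by
  open LegendrianTorus in
  obtain ⟨k, h0, h1, hk, p, q, hq, hq2, hp, hpq, hrot⟩ :=
    exists_rot_eq (show 0 < min (1 / 2) (ε / 7) by positivity)
  have H := (isProfile_curve h0.le h1).rescale (q := q) (by exact_mod_cast hq.pos)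
  have hz := curveZ_periodic hrot h0.le h1 hq.pos
  have hw := curveW_periodic hrot h0.le h1 hq.pos
  have hK := fun p => (H.gaussCurvature_eq hz hw p).trans (curvature_curve h0.le h1 _)
  have hb : ∀ p, |gaussCurvature (ofPlane _ H.norm_surface) p| ≤ 7 * k := fun p => by
    rw [hK p]
    exact abs_curvature_le h0.le (hk.le.trans (min_le_left _ _)) _
  refine ⟨ofPlane _ H.norm_surface,
    H.isSmoothlyEmbedded hz hw (exp_eq_of_curve_eq hrot h0 h1 hq hq2 hp hpq),
    H.isLegendrian hz hw, H.isMinimal hz hw, fun hflat => ?_,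
    ⟨7 * k, by rintro _ ⟨p, rfl⟩; exact hb p⟩, (ciSup_le hb).trans_lt ?_⟩
  -- At angle zero, vanishing curvature would mean `(1 - k)² = 1 + k`, impossible for `0 < k < 1`.
  · have h := hflat 1
    rw [hK 1] at h
    simp only [Prod.fst_one, Circle.coe_one, Complex.arg_one, mul_zero, Real.cos_zero, mul_one]
      at h
    rw [sub_eq_zero, eq_div_iff (by positivity)] at h
    nlinarith [pow_pos h0 2, pow_pos h0 3, mul_pos h0 (sub_pos.2 h1)]
  · have := hk.trans_le (min_le_right _ _)
    linarith
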